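/- Let $K$ be an o-minimal structure expanding an ordered field; "definable" means definable in $K$ with parameters, $|\cdot|$ is the Euclidean norm on $K^n$, and $x\in K$ is called finite if $|x|\le N$ for some $N\in\mathbb N$. For $X\subseteq K^n$ and $M\in K_{>0}$, a definable $M$-function $f:X\to K^m$ is a definable function that is differentiable on $X$ (relative to $X$) and satisfies $|Df(x)v|\le M|v|$ for all $x\in X$ and all $v$ in the tangent space $T_xX$ (which is $K^n$ if $X$ is open). $M$-cells are defined inductively. The $M$-cells in $K^1$ are the points $\{r\}$ and the intervals $(a,b)$ with $a<b$ in $K$. The $M$-cells in $K^{n+1}$ are the graphs $\Gamma(f)$ and the sets $(f,g)_X=\{(x,r)\in X\times K: f(x)<r<g(x)\}$, where $X\subseteq K^n$ is an $M$-cell and $f,g:X\to K$ are definable $M$-functions of class $C^1$, with $f<g$ on $X$ in the second case. A function $f:X\to K^m$ is $M$-Lipschitz if $|f(x)-f(y)|\le M|x-y|$ for all $x,y\in X$. An $M$-cell is an $M$-Lipschitz cell if all functions that define it, at every stage of the induction, are $M$-Lipschitz. Theorem. (1) For all $n\ge 1$ and $L\in K_{>0}$ there is $k(n,L)\in K_{>0}$,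 depending only on $n$ and $L$ and finite if $L$ is finite, such that every $L$-cell $C\subseteq K^n$ is a $k(n,L)$-Lipschitz cell. (2) For all $n\ge 1$ and $L\in K_{>0}$ there is $K(n,L)\in K_{>0}$, depending only on $n$ and $L$ and finite if $L$ is finite, such that for every $L$-Lipschitz cell $C\subseteq K^n$ there is a definable family of curves $\gamma_{x,y}:[0,1]\to C$, parametrized by $(x,y)\in C^2$, such that for all $x,y\in C$ the curve $\gamma_{x,y}$ is $C^1$ on $[0,1]$, $\gamma_{x,y}(0)=x$, $\gamma_{x,y}(1)=y$, and $|\gamma_{x,y}'(t)|\le K(n,L)\,|x-y|$ for all $t\in[0,1]$. (3) Let $M,N\in K_{>0}$, let $C\subseteq K^n$ be an $M$-cell and let $f:C\to K^m$ be a definable $N$-function. Then there is $c\in K_{>0}$ such that $f$ is $c$-Lipschitz, and $c$ can be chosen finite if $M$ and $N$ are finite. -/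

import Mathlib

open Set Filter Topology

namespace OMin

/-- Points, and open intervals with endpoints in `K ∪ {-∞, +∞}`. -/
def IsPointOrInterval {K : Type*} [LinearOrder K] (I : Set K) : Prop :=
  (∃ a, I = {a}) ∨ (∃ a b, I = Ioo a b) ∨ (∃ a, I = Ioi a) ∨ (∃ b, I = Iio b) ∨ I = univ

/-- The first-order `L`-structure on the ordered field `K` is an o-minimal structure expanding
the ordered field: order, addition and multiplication are definable, and every definable subset
of `K` is a finite union of points and intervals. Here and below, "definable" means definable in
the structure with arbitrary parameters from `K`. -/
class OMinimalField (L : FirstOrder.Language) (K : Type*) [Field K] [LinearOrder K]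
    [IsStrictOrderedRing K] [L.Structure K] : Prop where
  lt_definable : (univ : Set K).Definable L {v : Fin 2 → K | v 0 < v 1}
  add_definable : (univ : Set K).Definable L {v : Fin 3 → K | v 0 + v 1 = v 2}
  mul_definable : (univ : Set K).Definable L {v : Fin 3 → K | v 0 * v 1 = v 2}
  o_minimal : ∀ S : Set K, (univ : Set K).Definable₁ L S →
    ∃ F : Set (Set K), F.Finite ∧ (∀ I ∈ F, IsPointOrInterval I) ∧ S = ⋃₀ F

/-- Finite elements of an ordered field: those bounded in absolute value by a natural number. -/
def IsFiniteElt {K : Type*} [Field K] [LinearOrder K] (x : K) : Prop :=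
  ∃ N : ℕ, |x| ≤ (N : K)

/-- The square of the Euclidean norm. For `C > 0`, the inequality `|v| ≤ C * |w|` between
Euclidean norms is written `normSq v ≤ C ^ 2 * normSq w`, so that square roots in `K` are not
needed. -/
def normSq {K : Type*} [Field K] {ι : Type*} [Fintype ι] (v : ι → K) : K :=
  ∑ i, v i ^ 2

/-- `f : X → K^m` is a definable function: its graph (over `X`) is a definable set. -/
def DefinableOn (L : FirstOrder.Language) {K : Type*} [L.Structure K] {α β : Type*}
    (X : Set (α → K)) (f : (α → K) → (β → K)) : Prop :=
  (univ : Set K).Definable L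
    {w : α ⊕ β → K | w ∘ Sum.inl ∈ X ∧ w ∘ Sum.inr = f (w ∘ Sum.inl)}

section Calculus

variable {K : Type*} [Field K] [LinearOrder K] [TopologicalSpace K]

/-- The matrix `A` is a differential of `f : X → K^m` at `x`, relative to `X`:
`f y = f x + A (y - x) + o(|y - x|)` as `y → x` in `X`. Its restriction to the tangent space of
`X` at `x` is determined by `f`. -/
def HasDifferentialWithinAt {n m : ℕ} (f : (Fin n → K) → (Fin m → K)) (X : Set (Fin n → K))
    (x : Fin n → K) (A : Matrix (Fin m) (Fin n) K) : Prop :=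
  ∀ ε : K, 0 < ε → ∀ᶠ y in 𝓝[X] x,
    normSq (f y - f x - A.mulVec (y - x)) ≤ ε ^ 2 * normSq (y - x)

/-- `f` is of class `C¹` on `X`: it is differentiable at each point of `X`, relative to `X`, with
a differential that varies continuously on `X`. (For open `X` this is the usual notion; for a
`C¹`-cell `X` of any dimension it is the same as having a `C¹` extension to an open
neighbourhood of `X`.) -/
def IsC1On {n m : ℕ} (f : (Fin n → K) → (Fin m → K)) (X : Set (Fin n → K)) : Prop :=
  ∃ A : (Fin n → K) → Matrix (Fin m) (Fin n) K,
    ContinuousOn A X ∧ ∀ x ∈ X, HasDifferentialWithinAt f X x (A x)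

/-- `f : X → K^m` is a definable `M`-function: it is definable, differentiable, and its
differential `Df(x)`, as a linear map on the tangent space of `X` at `x`, has Euclidean operator
norm at most `M` for all `x ∈ X`. (For open `X` the tangent space is all of `K^n`.) -/
def IsMFunction (L : FirstOrder.Language) [L.Structure K] {n m : ℕ} (M : K)
    (X : Set (Fin n → K)) (f : (Fin n → K) → (Fin m → K)) : Prop :=
  DefinableOn L X f ∧
    ∀ x ∈ X, ∃ A : Matrix (Fin m) (Fin n) K, HasDifferentialWithinAt f X x A ∧
      ∀ v ∈ tangentConeAt K X x, normSq (A.mulVec v) ≤ M ^ 2 * normSq v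

/-- `γ : [0,1] → K^n` is a `C¹`-curve with derivative `γ'` (one-sided at the endpoints). -/
def IsC1Curve {n : ℕ} (γ γ' : K → (Fin n → K)) : Prop :=
  ContinuousOn γ' (Icc 0 1) ∧
    ∀ t ∈ Icc (0 : K) 1, ∀ ε : K, 0 < ε → ∀ᶠ s in 𝓝[Icc 0 1] t,
      normSq (γ s - γ t - (s - t) • γ' t) ≤ ε ^ 2 * (s - t) ^ 2

end Calculus

/-- `f` is `C`-Lipschitz on `X` (for `C > 0`): `|f x - f y| ≤ C * |x - y|` in Euclidean norms. -/
def IsLipschitzOn {K : Type*} [Field K] [LinearOrder K] {n m : ℕ} (C : K)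
    (X : Set (Fin n → K)) (f : (Fin n → K) → (Fin m → K)) : Prop :=
  ∀ x ∈ X, ∀ y ∈ X, normSq (f x - f y) ≤ C ^ 2 * normSq (x - y)

/-- The graph of `f : X → K`, for `X ⊆ K^n`, as a subset of `K^(n+1)`. -/
def graphOver {K : Type*} {n : ℕ} (X : Set (Fin n → K)) (f : (Fin n → K) → K) :
    Set (Fin (n + 1) → K) :=
  {z | Fin.init z ∈ X ∧ z (Fin.last n) = f (Fin.init z)}

/-- The set `(f, g)_X = {(x, r) ∈ X × K : f x < r < g x}`, as a subset of `K^(n+1)`. -/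
def bandOver {K : Type*} [LinearOrder K] {n : ℕ} (X : Set (Fin n → K))
    (f g : (Fin n → K) → K) : Set (Fin (n + 1) → K) :=
  {z | Fin.init z ∈ X ∧ f (Fin.init z) < z (Fin.last n) ∧ z (Fin.last n) < g (Fin.init z)}

/-- Cells in `K^n`, `n ≥ 1`, all of whose defining functions `f` (at every stage of the inductive
construction, `f` having domain `X`) satisfy the condition `P X f`. -/
inductive IsCellWith {K : Type*} [LinearOrder K]
    (P : ∀ n : ℕ, Set (Fin n → K) → ((Fin n → K) → K) → Prop) :
    ∀ n : ℕ, Set (Fin n → K) → Prop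
  | point (r : K) : IsCellWith P 1 {x | x 0 = r}
  | interval (a b : K) (hab : a < b) : IsCellWith P 1 {x | a < x 0 ∧ x 0 < b}
  | graph {n : ℕ} {X : Set (Fin n → K)} {f : (Fin n → K) → K}
      (hX : IsCellWith P n X) (hf : P n X f) : IsCellWith P (n + 1) (graphOver X f)
  | band {n : ℕ} {X : Set (Fin n → K)} {f g : (Fin n → K) → K}
      (hX : IsCellWith P n X) (hf : P n X f) (hg : P n X g) (hfg : ∀ x ∈ X, f x < g x) :
      IsCellWith P (n + 1) (bandOver X f g)

/-- `M`-cells in `K^n`: the defining functions are definable `M`-functions of class `C¹`. -/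
def IsMCell (L : FirstOrder.Language) {K : Type*} [Field K] [LinearOrder K] [TopologicalSpace K]
    [L.Structure K] (M : K) {n : ℕ} (C : Set (Fin n → K)) : Prop :=
  IsCellWith (fun _ X f => IsMFunction L M X (fun x (_ : Fin 1) => f x) ∧
    IsC1On (fun x (_ : Fin 1) => f x) X) n C

/-- `M`-Lipschitz cells in `K^n`: `M`-cells whose defining functions are `M`-Lipschitz. -/
def IsLipschitzCell (L : FirstOrder.Language) {K : Type*} [Field K] [LinearOrder K]
    [TopologicalSpace K] [L.Structure K] (M : K) {n : ℕ} (C : Set (Fin n → K)) : Prop :=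
  IsCellWith (fun _ X f => (IsMFunction L M X (fun x (_ : Fin 1) => f x) ∧
    IsC1On (fun x (_ : Fin 1) => f x) X) ∧ IsLipschitzOn M X (fun x (_ : Fin 1) => f x)) n C

/-- `γ` is a definable family of curves `γ_a : [0,1] → B`, parametrized by `a ∈ A`: the set of
all `(a, t, b)` with `a ∈ A`, `t ∈ [0,1]`, `b = γ_a(t)` is definable, and `γ_a(t) ∈ B`. -/
def IsDefinableFamilyOfCurves (L : FirstOrder.Language) {K : Type*} [Field K] [LinearOrder K]
    [L.Structure K] {α β : Type*} (A : Set (α → K)) (B : Set (β → K))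
    (γ : (α → K) → K → (β → K)) : Prop :=
  (univ : Set K).Definable L
    {w : α ⊕ (Unit ⊕ β) → K | w ∘ Sum.inl ∈ A ∧ w (Sum.inr (Sum.inl ())) ∈ Icc 0 1 ∧
      w ∘ Sum.inr ∘ Sum.inr = γ (w ∘ Sum.inl) (w (Sum.inr (Sum.inl ())))} ∧
  ∀ a ∈ A, ∀ t ∈ Icc (0 : K) 1, γ a t ∈ B

/-- The product `C × C`, as a set of tuples. -/
def square {K : Type*} {n : ℕ} (C : Set (Fin n → K)) : Set (Fin n ⊕ Fin n → K) :=
  {w | w ∘ Sum.inl ∈ C ∧ w ∘ Sum.inr ∈ C}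

end OMin

/-!
Everything follows from the existence of good curves in Lipschitz cells, part (2), together with
the mean value inequality in an o-minimal field.

*Mean value inequality.* A definable function on `[0,1]` with derivative at most `c` grows by at
most `c` (`sub_le_mul_of_hasDerivUnit_le`): the set of points violating `g t ≤ g 0 + (c + ε) t` is
definable, so it would have an infimum, and the usual local argument excludes every position of
that infimum. Applied to the component of a curve along its total displacement this bounds curves
in `K^m`, without square roots (`normSq_sub_le_of_hasDerivUnit`). Derivatives of curves are limits
of difference quotients (`HasDerivUnit`), and velocities of curves in `X` are tangent to `X`. Hence
an `N`-function on a set whose points are joined by curves with constant `κ` is `N * κ`-Lipschitz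
(`IsMFunction.isLipschitzOn`).

*Curves in cells.* They are built along the cell, starting from segments in dimension one. Over a
graph a curve of the base is lifted by the defining function. In a band `(f, g)_X` the curve of the
base is lifted to relative height `(1 - t) * lam + t * μ`, where `lam` and `μ` are the relative
heights of the endpoints. The only term of the vertical velocity that needs care is
`(μ - lam) * (g - f)`: at the starting point it equals the difference of the heights of the
endpoints up to increments of `f` and `g` between the projected endpoints, and along the curve
`g - f` changes by a bounded multiple of the distance, because `f` and `g` are Lipschitz
(`band_velocity_bound`). Each dimension costs a factor `3 + 5 * M`
(`IsLipschitzCell.hasCurves`).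

*Parts (1) and (3).* By induction on the dimension the base of an `M`-cell is a Lipschitz cell, so
it is joined by curves and the defining `M`-functions on it are Lipschitz, with the constants
`lipConst`. Part (3) is the same argument for the given function.

Definability of the families is tracked through total functions: a definable function on a cell is
extended by zero, and the curves are compositions of such functions.
-/

namespace OMin

/-! ### Definable functions -/

section Definability

variable {L : FirstOrder.Language} {K : Type*} [L.Structure K] {α β : Type*}

theorem definableFun_const (c : K) : (univ : Set K).DefinableFun L (fun _ : α → K => c) :=
  L.definableFun_const α (mem_univ c)

theorem DefinableOn.definable_domain [Finite α] [Finite β] {X : Set (α → K)}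
    {f : (α → K) → (β → K)} (hf : DefinableOn L X f) : (univ : Set K).Definable L X := by
  convert! Definable.image_comp hf Sum.inl using 1
  ext x
  constructor
  · intro hx
    exact ⟨Sum.elim x (f x), by simpa using hx, by simp⟩
  · rintro ⟨w, hw, rfl⟩
    exact hw.1

variable [Field K]

/-- The coordinates of a definable function on `X`, extended by zero, are definable. -/
theorem DefinableOn.definableFun_indicator [Finite α] [Finite β] {X : Set (α → K)}
    {f : (α → K) → (β → K)} (hf : DefinableOn L X f) (j : β) :
    (univ : Set K).DefinableFun L (X.indicator fun x => f x j) := by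
  have hX := hf.definable_domain
  have h1 := (Definable.image_comp hf
    (fun o : Option α => o.elim (Sum.inr j) Sum.inl))
  have h2 : (univ : Set K).Definable L {w : Option α → K | w none = 0} :=
    (DefinableFun.proj L).ofPred_eq (definableFun_const 0)
  have h3 := hX.preimage_comp (some : α → Option α)
  unfold DefinableFun
  convert! h1.union (h2.inter h3.compl) using 1
  ext w
  simp only [Function.tupleGraph, mem_ofPred_eq, mem_union, mem_inter_iff, mem_image, mem_compl_iff,
    mem_preimage]
  by_cases hw : w ∘ some ∈ X
  · simp only [indicator_of_mem hw, hw, not_true_eq_false, and_false, or_false]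
    constructor
    · intro h
      refine ⟨Sum.elim (w ∘ some) (f (w ∘ some)), by simpa using hw, ?_⟩
      ext o
      cases o <;> simp [h]
    · rintro ⟨u, ⟨_, hu⟩, rfl⟩
      exact (congrFun hu j).symm
  · simp only [indicator_of_notMem hw, hw, not_false_eq_true, and_true]
    constructor
    · exact fun h => Or.inr h.symm
    · rintro (⟨u, ⟨hu, _⟩, rfl⟩ | h)
      · exact absurd hu hw
      · exact h.symm

variable [LinearOrder K] [IsStrictOrderedRing K] [OMinimalField L K]


theorem definableFun_add {F G : (α → K) → K} (hF : (univ : Set K).DefinableFun L F)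
    (hG : (univ : Set K).DefinableFun L G) :
    (univ : Set K).DefinableFun L (fun v => F v + G v) := by
  have h : (univ : Set K).DefinableFun L (fun u : Fin 2 → K => u 0 + u 1) := by
    have := (OMinimalField.add_definable (L := L) (K := K)).preimage_comp
      (![some 0, some 1, none] : Fin 3 → Option (Fin 2))
    simpa [DefinableFun, Function.tupleGraph, preimage] using! this
  have hm : (univ : Set K).DefinableMap L (fun v => ![F v, G v]) := by
    simp [DefinableMap, *]
  simpa using h.comp hm

theorem definableFun_mul {F G : (α → K) → K} (hF : (univ : Set K).DefinableFun L F)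
    (hG : (univ : Set K).DefinableFun L G) :
    (univ : Set K).DefinableFun L (fun v => F v * G v) := by
  have h : (univ : Set K).DefinableFun L (fun u : Fin 2 → K => u 0 * u 1) := by
    have := (OMinimalField.mul_definable (L := L) (K := K)).preimage_comp
      (![some 0, some 1, none] : Fin 3 → Option (Fin 2))
    simpa [DefinableFun, Function.tupleGraph, preimage] using! this
  have hm : (univ : Set K).DefinableMap L (fun v => ![F v, G v]) := by
    simp [DefinableMap, *]
  simpa using h.comp hm

theorem definableFun_sub {F G : (α → K) → K} (hF : (univ : Set K).DefinableFun L F)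
    (hG : (univ : Set K).DefinableFun L G) :
    (univ : Set K).DefinableFun L (fun v => F v - G v) := by
  simpa [sub_eq_add_neg] using
    definableFun_add hF (definableFun_mul (definableFun_const (-1)) hG)

theorem definableFun_sum {ι : Type*} (s : Finset ι) {F : ι → (α → K) → K}
    (hF : ∀ i ∈ s, (univ : Set K).DefinableFun L (F i)) :
    (univ : Set K).DefinableFun L (fun v => ∑ i ∈ s, F i v) := by
  classical
  induction s using Finset.induction_on with
  | empty => simpa using definableFun_const 0
  | insert a s ha ih =>
    simp only [Finset.sum_insert ha]
    exact definableFun_add (hF a (by simp)) (ih fun i hi => hF i (by simp [hi]))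

theorem definable_lt {F G : (α → K) → K} (hF : (univ : Set K).DefinableFun L F)
    (hG : (univ : Set K).DefinableFun L G) :
    (univ : Set K).Definable L {v | F v < G v} := by
  have hm : (univ : Set K).DefinableMap L (fun v => ![F v, G v]) := by
    simp [DefinableMap, *]
  exact (OMinimalField.lt_definable (L := L) (K := K)).preimage_map hm

theorem definable_le {F G : (α → K) → K} (hF : (univ : Set K).DefinableFun L F)
    (hG : (univ : Set K).DefinableFun L G) :
    (univ : Set K).Definable L {v | F v ≤ G v} := by
  convert! (definable_lt hG hF).compl using 1
  ext v
  simp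

theorem definableFun_inv {F : (α → K) → K} (hF : (univ : Set K).DefinableFun L F) :
    (univ : Set K).DefinableFun L (fun v => (F v)⁻¹) := by
  have h : (univ : Set K).DefinableFun L (fun u : Fin 1 → K => (u 0)⁻¹) := by
    have h1 : (univ : Set K).Definable L
        {w : Option (Fin 1) → K | w none * w (some 0) = 1} :=
      (definableFun_mul (.proj L) (.proj L)).ofPred_eq (definableFun_const 1)
    have h2 : (univ : Set K).Definable L {w : Option (Fin 1) → K | w none = 0} :=
      (DefinableFun.proj L).ofPred_eq (definableFun_const 0)
    have h3 : (univ : Set K).Definable L {w : Option (Fin 1) → K | w (some 0) = 0} :=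
      (DefinableFun.proj L).ofPred_eq (definableFun_const 0)
    unfold DefinableFun
    convert! h1.union (h2.inter h3) using 1
    ext w
    simp only [Function.tupleGraph, mem_ofPred_eq, mem_union, mem_inter_iff, Function.comp_apply]
    by_cases h0 : w (some 0) = 0
    · simp [h0, eq_comm]
    · simp only [h0, and_false, or_false]
      rw [eq_comm, mul_eq_one_iff_eq_inv₀ h0]
  exact h.comp (g := fun v _ => F v) fun _ => hF

theorem definableFun_div {F G : (α → K) → K} (hF : (univ : Set K).DefinableFun L F)
    (hG : (univ : Set K).DefinableFun L G) :
    (univ : Set K).DefinableFun L (fun v => F v / G v) := by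
  simpa [div_eq_mul_inv] using definableFun_mul hF (definableFun_inv hG)

end Definability

/-! ### Definable completeness -/

section Completeness

variable {L : FirstOrder.Language} {K : Type*} [Field K] [LinearOrder K] [IsStrictOrderedRing K]

theorem IsPointOrInterval.exists_isGLB {I : Set K} (hI : IsPointOrInterval I) (hne : I.Nonempty)
    (hb : BddBelow I) : ∃ a, IsGLB I a := by
  rcases hI with ⟨a, rfl⟩ | ⟨a, b, rfl⟩ | ⟨a, rfl⟩ | ⟨b, rfl⟩ | rfl
  · exact ⟨a, isGLB_singleton⟩
  · exact ⟨a, isGLB_Ioo (nonempty_Ioo.1 hne)⟩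
  · exact ⟨a, isGLB_Ioi⟩
  · exact absurd hb (not_bddBelow_Iio b)
  · exact absurd hb not_bddBelow_univ

variable [L.Structure K] [OMinimalField L K]

/-- Definable completeness: a nonempty definable set that is bounded below has an infimum. -/
theorem exists_isGLB_of_definable {S : Set K} (hS : (univ : Set K).Definable₁ L S)
    (hne : S.Nonempty) (hb : BddBelow S) : ∃ a, IsGLB S a := by
  obtain ⟨F, hF, hI, rfl⟩ := OMinimalField.o_minimal S hS
  clear hS
  induction F, hF using Set.Finite.induction_on with
  | empty => simp at hne
  | @insert I F _ _ ih =>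
    rw [sUnion_insert] at hb ⊢
    obtain ⟨hbI, hbF⟩ := bddBelow_union.1 hb
    have hI' := hI I (mem_insert _ _)
    rcases I.eq_empty_or_nonempty with rfl | hIn
    · rw [sUnion_insert] at hne
      rw [empty_union] at hne ⊢
      exact ih (fun J hJ => hI J (mem_insert_of_mem _ hJ)) hne hbF
    obtain ⟨a, ha⟩ := hI'.exists_isGLB hIn hbI
    rcases (⋃₀ F).eq_empty_or_nonempty with h | h
    · rw [h, union_empty]
      exact ⟨a, ha⟩
    · obtain ⟨b, hb⟩ := ih (fun J hJ => hI J (mem_insert_of_mem _ hJ)) h hbF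
      exact ⟨a ⊓ b, ha.union hb⟩

end Completeness

/-! ### Squared Euclidean norms -/

section NormSq

variable {K : Type*} [Field K] {ι : Type*} [Fintype ι]

theorem normSq_smul (c : K) (v : ι → K) : normSq (c • v) = c ^ 2 * normSq v := by
  simp [normSq, mul_pow, Finset.mul_sum]

theorem normSq_sub_comm (v w : ι → K) : normSq (v - w) = normSq (w - v) := by
  simp only [normSq, Pi.sub_apply]
  exact Finset.sum_congr rfl fun i _ => by ring

theorem normSq_fin_one (v : Fin 1 → K) : normSq v = v 0 ^ 2 := by
  simp [normSq]

theorem normSq_eq_init_add {n : ℕ} (v : Fin (n + 1) → K) :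
    normSq v = normSq (Fin.init v) + v (Fin.last n) ^ 2 := by
  simp [normSq, Fin.sum_univ_castSucc, Fin.init]

variable [LinearOrder K] [IsStrictOrderedRing K]

theorem normSq_nonneg (v : ι → K) : 0 ≤ normSq v :=
  Finset.sum_nonneg fun i _ => sq_nonneg (v i)

theorem sq_le_normSq (v : ι → K) (i : ι) : v i ^ 2 ≤ normSq v :=
  Finset.single_le_sum (f := fun i => v i ^ 2) (fun i _ => sq_nonneg (v i)) (Finset.mem_univ i)

theorem continuous_normSq [TopologicalSpace K] [OrderTopology K] :
    Continuous (normSq : (ι → K) → K) := by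
  unfold normSq
  fun_prop

end NormSq

/-! ### Differentiation on the unit interval -/

section Deriv

variable {K : Type*} [Field K] [LinearOrder K] [TopologicalSpace K]

/-- `v` is the derivative at `t`, relative to `[0,1]`, of the curve `u` in `E`, as the limit of
difference quotients. -/
def HasDerivUnit {E : Type*} [AddCommGroup E] [Module K E] [TopologicalSpace E] (u : K → E) (v : E)
    (t : K) : Prop :=
  Tendsto (fun s => (s - t)⁻¹ • (u s - u t)) (𝓝[Icc 0 1 \ {t}] t) (𝓝 v)

theorem hasDerivUnit_pi {ι : Type*} {u : K → ι → K} {v : ι → K} {t : K} :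
    HasDerivUnit u v t ↔ ∀ i, HasDerivUnit (fun s => u s i) (v i) t := by
  simp [HasDerivUnit, tendsto_pi_nhds]

theorem HasDerivUnit.congr {E : Type*} [AddCommGroup E] [Module K E] [TopologicalSpace E]
    {u₁ u : K → E} {v : E} {t : K} (h : HasDerivUnit u v t)
    (hu : EqOn u₁ u (Icc 0 1)) (ht : t ∈ Icc (0 : K) 1) : HasDerivUnit u₁ v t := by
  refine Tendsto.congr' ?_ h
  filter_upwards [self_mem_nhdsWithin] with s hs
  rw [hu hs.1, hu ht]

theorem eventually_ne_nhdsWithin_diff (t : K) : ∀ᶠ s in 𝓝[Icc 0 1 \ {t}] t, s - t ≠ 0 := by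
  filter_upwards [self_mem_nhdsWithin] with s hs
  exact sub_ne_zero.2 hs.2

theorem continuousWithinAt_of_diff {E : Type*} [TopologicalSpace E] {u : K → E} {t : K}
    (h : Tendsto u (𝓝[Icc 0 1 \ {t}] t) (𝓝 (u t))) : ContinuousWithinAt u (Icc 0 1) t :=
  continuousWithinAt_sdiff_self.1 h

theorem HasDerivUnit.add {E : Type*} [AddCommGroup E] [Module K E]
    [TopologicalSpace E] [ContinuousAdd E] {u w : K → E} {u' w' : E} {t : K}
    (hu : HasDerivUnit u u' t) (hw : HasDerivUnit w w' t) :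
    HasDerivUnit (fun s => u s + w s) (u' + w') t := by
  refine (Tendsto.add hu hw).congr fun s => ?_
  rw [← smul_add, add_sub_add_comm]

theorem HasDerivUnit.sub {E : Type*} [AddCommGroup E] [Module K E] [TopologicalSpace E]
    [IsTopologicalAddGroup E] {u w : K → E} {u' w' : E} {t : K}
    (hu : HasDerivUnit u u' t) (hw : HasDerivUnit w w' t) :
    HasDerivUnit (fun s => u s - w s) (u' - w') t := by
  refine (Tendsto.sub hu hw).congr fun s => ?_
  rw [← smul_sub, sub_sub_sub_comm]

theorem hasDerivUnit_affine (a b t : K) : HasDerivUnit (fun s : K => a + s * b) b t := by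
  refine (tendsto_const_nhds (x := b)).congr' ?_
  filter_upwards [eventually_ne_nhdsWithin_diff t] with s hs
  rw [smul_eq_mul]
  field_simp
  ring

variable [IsStrictOrderedRing K] [OrderTopology K]

theorem neBot_nhdsWithin_Icc_diff {t : K} (ht : t ∈ Icc (0 : K) 1) :
    (𝓝[Icc (0 : K) 1 \ {t}] t).NeBot := by
  obtain ⟨h0, h1⟩ := ht
  rcases h1.lt_or_eq with h1 | rfl
  · refine (nhdsGT_neBot_of_exists_gt ⟨1, h1⟩ : (𝓝[>] t).NeBot).mono ?_
    rw [← nhdsWithin_Ioo_eq_nhdsGT h1]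
    exact nhdsWithin_mono _ fun s hs => ⟨⟨h0.trans hs.1.le, hs.2.le⟩, hs.1.ne'⟩
  · have h : (0 : K) < 1 := zero_lt_one
    refine (nhdsLT_neBot_of_exists_lt ⟨0, h⟩ : (𝓝[<] (1 : K)).NeBot).mono ?_
    rw [← nhdsWithin_Ioo_eq_nhdsLT h]
    exact nhdsWithin_mono _ fun s hs => ⟨⟨hs.1.le, hs.2.le⟩, hs.2.ne⟩

theorem tendsto_sub_nhdsWithin_diff (t : K) :
    Tendsto (fun s => s - t) (𝓝[Icc 0 1 \ {t}] t) (𝓝 0) := by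
  have : Tendsto (fun s => s - t) (𝓝 t) (𝓝 (t - t)) :=
    (continuous_id.sub continuous_const).tendsto t
  rw [sub_self] at this
  exact this.mono_left nhdsWithin_le_nhds

section Module

variable {E : Type*} [AddCommGroup E] [Module K E] [TopologicalSpace E]

theorem HasDerivUnit.tendsto_sub [ContinuousSMul K E] {u : K → E} {v : E} {t : K}
    (h : HasDerivUnit u v t) : Tendsto (fun s => u s - u t) (𝓝[Icc 0 1 \ {t}] t) (𝓝 0) := by
  have := (tendsto_sub_nhdsWithin_diff t).smul h
  rw [zero_smul] at this
  refine this.congr' ?_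
  filter_upwards [eventually_ne_nhdsWithin_diff t] with s hs
  rw [smul_inv_smul₀ hs]

theorem HasDerivUnit.continuousWithinAt [ContinuousSMul K E] [ContinuousAdd E] {u : K → E} {v : E}
    {t : K} (h : HasDerivUnit u v t) : ContinuousWithinAt u (Icc 0 1) t := by
  apply continuousWithinAt_of_diff
  simpa using h.tendsto_sub.add_const (u t)

theorem HasDerivUnit.unique [T2Space E] {u : K → E} {v w : E} {t : K} (ht : t ∈ Icc (0 : K) 1)
    (h : HasDerivUnit u v t) (h' : HasDerivUnit u w t) : v = w :=
  have := neBot_nhdsWithin_Icc_diff ht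
  tendsto_nhds_unique h h'

end Module

theorem HasDerivUnit.mul {u w : K → K} {u' w' : K} {t : K}
    (hu : HasDerivUnit u u' t) (hw : HasDerivUnit w w' t) :
    HasDerivUnit (fun s => u s * w s) (u' * w t + u t * w') t := by
  have hwt : Tendsto w (𝓝[Icc 0 1 \ {t}] t) (𝓝 (w t)) := by
    simpa using hw.tendsto_sub.add_const (w t)
  refine ((Tendsto.mul hu hwt).add (Tendsto.const_mul (u t) hw)).congr fun s => ?_
  simp only [smul_eq_mul]
  ring

theorem HasDerivUnit.sum_const_mul {ι : Type*} [Fintype ι] {u : K → ι → K} {v : ι → K} {t : K}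
    (h : HasDerivUnit u v t) (w : ι → K) :
    HasDerivUnit (fun s => ∑ i, w i * u s i) (∑ i, w i * v i) t := by
  refine (tendsto_finsetSum _ fun i _ => Tendsto.const_mul (w i)
    (hasDerivUnit_pi.1 h i)).congr fun s => ?_
  simp only [smul_eq_mul]
  rw [← Finset.sum_sub_distrib, Finset.mul_sum]
  exact Finset.sum_congr rfl fun i _ => by ring

/-- A velocity of a curve in `X` is a tangent vector of `X`. -/
theorem HasDerivUnit.mem_tangentConeAt {n : ℕ} {X : Set (Fin n → K)} {γ : K → Fin n → K}
    {v : Fin n → K} {t : K} (ht : t ∈ Icc (0 : K) 1) (hγ : HasDerivUnit γ v t)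
    (hX : MapsTo γ (Icc 0 1) X) : v ∈ tangentConeAt K X (γ t) := by
  have := neBot_nhdsWithin_Icc_diff ht
  refine mem_tangentConeAt_of_seq (𝓝[Icc (0 : K) 1 \ {t}] t) (fun s => (s - t)⁻¹)
    (fun s => γ s - γ t) hγ.tendsto_sub ?_ hγ
  filter_upwards [self_mem_nhdsWithin] with s hs
  simpa using hX hs.1

/-- A vector-valued quantity tends to zero if its squared norm is eventually below every `ε ^ 2`. -/
theorem tendsto_zero_of_normSq_le {α : Type*} {l : Filter α} {m : ℕ} {R : α → Fin m → K}
    (h : ∀ ε : K, 0 < ε → ∀ᶠ s in l, normSq (R s) ≤ ε ^ 2) : Tendsto R l (𝓝 0) := by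
  rw [tendsto_pi_nhds]
  intro i
  rw [Pi.zero_apply, (nhds_basis_abs_sub_lt (0 : K)).tendsto_right_iff]
  intro ε hε
  filter_upwards [h (ε / 2) (by positivity)] with s hs
  have h1 : |R s i| ≤ ε / 2 := abs_le_of_sq_le_sq ((sq_le_normSq (R s) i).trans hs) (by positivity)
  rw [sub_zero]
  linarith

/-- The chain rule for a differentiable function on `X` and a curve in `X`. -/
theorem HasDifferentialWithinAt.comp_curve {n m : ℕ} {f : (Fin n → K) → (Fin m → K)}
    {X : Set (Fin n → K)} {γ : K → Fin n → K} {v : Fin n → K} {t : K}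
    {A : Matrix (Fin m) (Fin n) K} (hf : HasDifferentialWithinAt f X (γ t) A)
    (hγ : HasDerivUnit γ v t) (hX : MapsTo γ (Icc 0 1) X) :
    HasDerivUnit (fun s => f (γ s)) (A.mulVec v) t := by
  have hγX : Tendsto γ (𝓝[Icc 0 1 \ {t}] t) (𝓝[X] (γ t)) := by
    refine tendsto_nhdsWithin_iff.2 ⟨by simpa using hγ.tendsto_sub.add_const (γ t), ?_⟩
    filter_upwards [self_mem_nhdsWithin] with s hs using hX hs.1
  have hA : Tendsto (fun s => A.mulVec ((s - t)⁻¹ • (γ s - γ t))) (𝓝[Icc 0 1 \ {t}] t)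
      (𝓝 (A.mulVec v)) :=
    ((continuous_const.matrix_mulVec continuous_id).tendsto v).comp hγ
  -- The remainder of the first-order expansion, divided by `s - t`, tends to zero because the
  -- difference quotients of `γ` stay bounded.
  have hR : Tendsto (fun s => (s - t)⁻¹ • (f (γ s) - f (γ t) - A.mulVec (γ s - γ t)))
      (𝓝[Icc 0 1 \ {t}] t) (𝓝 0) := by
    apply tendsto_zero_of_normSq_le
    intro ε hε
    set B : K := normSq v + 1 with hB
    have hB1 : 1 ≤ B := by linarith [normSq_nonneg v]
    have hbd : ∀ᶠ s in 𝓝[Icc 0 1 \ {t}] t, normSq ((s - t)⁻¹ • (γ s - γ t)) < B :=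
      ((continuous_normSq.tendsto v).comp hγ).eventually_lt_const (by linarith)
    filter_upwards [hγX.eventually (hf (ε / B) (by positivity)), hbd] with s h1 h2
    rw [normSq_smul]
    calc _ ≤ ((s - t)⁻¹) ^ 2 * ((ε / B) ^ 2 * normSq (γ s - γ t)) := by gcongr
      _ = (ε / B) ^ 2 * normSq ((s - t)⁻¹ • (γ s - γ t)) := by rw [normSq_smul]; ring
      _ ≤ (ε / B) ^ 2 * B := by gcongr
      _ = ε ^ 2 / B := by field_simp
      _ ≤ ε ^ 2 := div_le_self (by positivity) hB1
  refine (by simpa using hR.add hA : Tendsto _ _ _).congr fun s => ?_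
  rw [Matrix.mulVec_smul, ← smul_add]
  congr 1
  abel

theorem isC1Curve_of_hasDerivUnit {n : ℕ} {γ γ' : K → Fin n → K} (hc : ContinuousOn γ' (Icc 0 1))
    (h : ∀ t ∈ Icc (0 : K) 1, HasDerivUnit γ (γ' t) t) : IsC1Curve γ γ' := by
  refine ⟨hc, fun t ht ε hε => ?_⟩
  have h1 : Tendsto (fun s => normSq ((s - t)⁻¹ • (γ s - γ t) - γ' t)) (𝓝[Icc 0 1 \ {t}] t)
      (𝓝 (normSq (γ' t - γ' t))) :=
    (continuous_normSq.tendsto _).comp ((h t ht).sub_const (γ' t))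
  have h2 := h1.eventually_lt_const (u := ε ^ 2) (by simpa [normSq] using pow_pos hε 2)
  rw [eventually_nhdsWithin_iff] at h2 ⊢
  filter_upwards [h2] with s hs hsI
  rcases eq_or_ne s t with rfl | hst
  · simp [normSq]
  · have hne : s - t ≠ 0 := sub_ne_zero.2 hst
    have h3 : γ s - γ t - (s - t) • γ' t = (s - t) • ((s - t)⁻¹ • (γ s - γ t) - γ' t) := by
      rw [smul_sub, smul_inv_smul₀ hne]
    rw [h3, normSq_smul, mul_comm]
    have := (hs ⟨hsI, hst⟩).le
    gcongr

end Deriv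

/-! ### The mean value inequality -/

section MeanValue

variable {L : FirstOrder.Language} {K : Type*} [Field K] [LinearOrder K] [IsStrictOrderedRing K]
  [TopologicalSpace K] [OrderTopology K] [L.Structure K] [OMinimalField L K]

/-- The mean value inequality for definable functions on the unit interval. If it failed with `c`
replaced by `c + ε`, the points of failure would have an infimum, by definable completeness. -/
theorem sub_le_mul_of_hasDerivUnit_le {g g' : K → K} {c : K}
    (hg : (univ : Set K).DefinableFun L (fun v : Fin 1 → K => g (v 0)))
    (h : ∀ t ∈ Icc (0 : K) 1, HasDerivUnit g (g' t) t) (hc : ∀ t ∈ Icc (0 : K) 1, g' t ≤ c)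
    {t : K} (ht : t ∈ Icc (0 : K) 1) : g t - g 0 ≤ c * t := by
  suffices H : ∀ ε : K, 0 < ε → ∀ t ∈ Icc (0 : K) 1, g t ≤ g 0 + (c + ε) * t by
    refine le_of_forall_pos_le_add fun ε hε => ?_
    have := H ε hε t ht
    nlinarith [ht.1, ht.2]
  intro ε hε
  by_contra! hV
  set V : Set K := {t | (0 ≤ t ∧ t ≤ 1) ∧ g 0 + (c + ε) * t < g t} with hVdef
  have hVd : (univ : Set K).Definable₁ L V :=
    ((definable_le (definableFun_const 0) (.proj L)).inter
      (definable_le (.proj L) (definableFun_const 1))).inter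
      (definable_lt (definableFun_add (definableFun_const _)
        (definableFun_mul (definableFun_const _) (.proj L))) hg)
  obtain ⟨σ, hσ⟩ := exists_isGLB_of_definable hVd (let ⟨t, ht, h⟩ := hV; ⟨t, ht, h⟩)
    ⟨0, fun t ht => ht.1.1⟩
  have hσI : σ ∈ Icc (0 : K) 1 := by
    obtain ⟨t, ht, h⟩ := hV
    exact ⟨hσ.2 fun t ht => ht.1.1, (hσ.1 ⟨ht, h⟩).trans ht.2⟩
  have hcont := (h σ hσI).continuousWithinAt
  have hσV : σ ∉ V := by
    intro hmem
    have hσ0 : 0 < σ := by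
      rcases hσI.1.lt_or_eq with h | h
      · exact h
      · rw [← h] at hmem
        simpa using hmem.2
    have hcont' : ContinuousWithinAt (fun t => g 0 + (c + ε) * t) (Icc 0 1) σ := by fun_prop
    have hev := (hcont'.tendsto.eventually_lt hcont.tendsto hmem.2).filter_mono
      (nhdsWithin_mono σ (show Ioo 0 σ ⊆ Icc 0 1 from
        fun s hs => ⟨hs.1.le, hs.2.le.trans hσI.2⟩))
    rw [nhdsWithin_Ioo_eq_nhdsLT hσ0] at hev
    have := nhdsLT_neBot_of_exists_lt ⟨0, hσ0⟩
    obtain ⟨s, hs, hs'⟩ := (hev.and (Ioo_mem_nhdsLT hσ0)).exists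
    exact absurd (hσ.1 ⟨⟨hs'.1.le, hs'.2.le.trans hσI.2⟩, hs⟩) (not_le.2 hs'.2)
  have hgσ : g σ ≤ g 0 + (c + ε) * σ := by
    by_contra! hlt
    exact hσV ⟨hσI, hlt⟩
  have hslope := (h σ hσI).eventually_lt_const (u := c + ε) (by linarith [hc σ hσI])
  rw [eventually_nhdsWithin_iff] at hslope
  have : ∃ δ > σ, ∀ s, σ < s → s < δ → s ∈ Icc (0 : K) 1 → s ∉ V := by
    obtain ⟨δ, hδ, hδ'⟩ := (nhdsGT_basis σ).eventually_iff.1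
      (hslope.filter_mono (nhdsWithin_le_nhds (s := Ioi σ)))
    refine ⟨δ, hδ, fun s h1 h2 h3 hs => ?_⟩
    have h4 := hδ' ⟨h1, h2⟩ ⟨h3, h1.ne'⟩
    have h5 : 0 < s - σ := sub_pos.2 h1
    rw [smul_eq_mul, inv_mul_lt_iff₀ h5] at h4
    have := hs.2
    linarith
  obtain ⟨δ, hδ, hδ'⟩ := this
  refine absurd (hσ.2 fun s hs => ?_ : δ ≤ σ) (not_le.2 hδ)
  by_contra! hlt
  have h1 := hσ.1 hs
  rcases h1.lt_or_eq with h1 | rfl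
  · exact hδ' s h1 hlt hs.1 hs
  · exact hσV hs

/-- A definable curve with velocity of squared length at most `B` moves by a vector of squared
length at most `B`. -/
theorem normSq_sub_le_of_hasDerivUnit {m : ℕ} {u u' : K → Fin m → K} {B : K}
    (hu : ∀ i, (univ : Set K).DefinableFun L (fun v : Fin 1 → K => u (v 0) i))
    (h : ∀ t ∈ Icc (0 : K) 1, HasDerivUnit u (u' t) t)
    (hB : ∀ t ∈ Icc (0 : K) 1, normSq (u' t) ≤ B) {t : K} (ht : t ∈ Icc (0 : K) 1) :
    normSq (u t - u 0) ≤ B := by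
  -- Apply the scalar inequality to the component of `u` along `w = u t - u 0`; the slope bound
  -- `c = (|w|² + B) / 2` dominates `⟨w, u'⟩` by Cauchy-Schwarz and AM-GM, and
  -- `c < |w|²` if `B < |w|²`.
  by_contra! hlt
  set w := u t - u 0 with hw
  set c := (normSq w + B) / 2 with hc
  have hB0 : 0 ≤ B := (normSq_nonneg _).trans (hB t ht)
  have hc0 : 0 < c := by linarith
  have hle := sub_le_mul_of_hasDerivUnit_le (L := L) (g := fun s => ∑ i, w i * u s i)
    (g' := fun s => ∑ i, w i * u' s i) (c := c)
    (definableFun_sum _ fun i _ => definableFun_mul (definableFun_const _) (hu i))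
    (fun s hs => (h s hs).sum_const_mul w) (fun s hs => by
      have h1 : (∑ i, w i * u' s i) ^ 2 ≤ normSq w * normSq (u' s) :=
        Finset.sum_mul_sq_le_sq_mul_sq _ _ _
      have h2 : normSq w * normSq (u' s) ≤ normSq w * B :=
        mul_le_mul_of_nonneg_left (hB s hs) (normSq_nonneg w)
      refine le_of_abs_le (abs_le_of_sq_le_sq ?_ hc0.le)
      nlinarith [sq_nonneg (normSq w - B)]) ht
  have h3 : ∑ i, w i * u t i - ∑ i, w i * u 0 i = normSq w := by
    rw [← Finset.sum_sub_distrib, normSq]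
    exact Finset.sum_congr rfl fun i _ => by simp only [hw, Pi.sub_apply]; ring
  rw [h3] at hle
  nlinarith [ht.1, ht.2]

end MeanValue

/-! ### Curves in cells -/

/-- A definable function of a member of a definable family of curves is definable. -/
theorem definableFun_family {L : FirstOrder.Language} {K : Type*} [L.Structure K] {n : ℕ}
    {γ : (Fin n ⊕ Fin n → K) → K → (Fin n → K)}
    (hγ : (univ : Set K).DefinableMap L
      (fun w : (Fin n ⊕ Fin n) ⊕ Unit → K => γ (w ∘ Sum.inl) (w (Sum.inr ()))))
    {F : (Fin n → K) → K} (hF : (univ : Set K).DefinableFun L F) (w : Fin n ⊕ Fin n → K) :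
    (univ : Set K).DefinableFun L (fun v : Fin 1 → K => F (γ w (v 0))) := by
  refine hF.comp fun i => ?_
  refine (hγ i).comp (g := fun v : Fin 1 → K => Sum.elim w (fun _ => v 0)) ?_
  rintro (i | i)
  · exact definableFun_const (w i)
  · exact .proj L

section Curves

variable {K : Type*} [Field K] [LinearOrder K] [TopologicalSpace K]

/-- `c` is a `C¹`-curve in `C` from `x` to `y`, with derivative `c'` of length at most
`κ * |x - y|`. -/
structure IsJoiningCurve {n : ℕ} (κ : K) (C : Set (Fin n → K)) (x y : Fin n → K)
    (c c' : K → Fin n → K) : Prop where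
  source : c 0 = x
  target : c 1 = y
  mapsTo : MapsTo c (Icc 0 1) C
  hasDeriv : ∀ t ∈ Icc (0 : K) 1, HasDerivUnit c (c' t) t
  continuousOn : ContinuousOn c' (Icc 0 1)
  bound : ∀ t ∈ Icc (0 : K) 1, normSq (c' t) ≤ κ ^ 2 * normSq (x - y)

/-- The points of `C` are joined by a definable family of `C¹`-curves in `C` with constant `κ`.
The family is given by total functions, definable in the parameters and the time jointly. -/
def HasCurves (L : FirstOrder.Language) [L.Structure K] {n : ℕ} (κ : K)
    (C : Set (Fin n → K)) : Prop :=
  ∃ γ : (Fin n ⊕ Fin n → K) → K → (Fin n → K),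
    (univ : Set K).DefinableMap L
      (fun w : (Fin n ⊕ Fin n) ⊕ Unit → K => γ (w ∘ Sum.inl) (w (Sum.inr ()))) ∧
    ∀ w ∈ square C, ∃ γ' : K → Fin n → K,
      IsJoiningCurve κ C (w ∘ Sum.inl) (w ∘ Sum.inr) (γ w) γ'

variable [IsStrictOrderedRing K]

theorem IsJoiningCurve.congr {n : ℕ} {κ : K} {C : Set (Fin n → K)} {x y : Fin n → K}
    {c₁ c c' : K → Fin n → K} (h : IsJoiningCurve κ C x y c c') (he : EqOn c₁ c (Icc 0 1)) :
    IsJoiningCurve κ C x y c₁ c' where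
  source := (he ⟨le_rfl, zero_le_one⟩).trans h.source
  target := (he ⟨zero_le_one, le_rfl⟩).trans h.target
  mapsTo := h.mapsTo.congr he.symm
  hasDeriv t ht := (h.hasDeriv t ht).congr he ht
  continuousOn := h.continuousOn
  bound := h.bound

theorem IsJoiningCurve.snoc {n : ℕ} {κ κ' : K} {X : Set (Fin n → K)}
    {C : Set (Fin (n + 1) → K)} {x y : Fin (n + 1) → K} {c c' : K → Fin n → K} {b b' : K → K}
    (hc : IsJoiningCurve κ X (Fin.init x) (Fin.init y) c c')
    (h0 : b 0 = x (Fin.last n)) (h1 : b 1 = y (Fin.last n))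
    (hb : ∀ t ∈ Icc (0 : K) 1, HasDerivUnit b (b' t) t) (hb' : ContinuousOn b' (Icc 0 1))
    (hC : ∀ t ∈ Icc (0 : K) 1, (Fin.snoc (c t) (b t) : Fin (n + 1) → K) ∈ C)
    (hbd : ∀ t ∈ Icc (0 : K) 1, κ ^ 2 * normSq (Fin.init x - Fin.init y) + b' t ^ 2 ≤
      κ' ^ 2 * normSq (x - y)) :
    IsJoiningCurve κ' C x y (fun t => Fin.snoc (c t) (b t)) (fun t => Fin.snoc (c' t) (b' t)) where
  source := by rw [hc.source, h0, Fin.snoc_init_self]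
  target := by rw [hc.target, h1, Fin.snoc_init_self]
  mapsTo := hC
  hasDeriv t ht := by
    rw [hasDerivUnit_pi]
    intro i
    refine Fin.lastCases ?_ (fun i => ?_) i
    · simpa using hb t ht
    · simpa using hasDerivUnit_pi.1 (hc.hasDeriv t ht) i
  continuousOn := by
    rw [continuousOn_pi]
    intro i
    refine Fin.lastCases ?_ (fun i => ?_) i
    · simpa using hb'
    · simpa using continuousOn_pi.1 hc.continuousOn i
  bound t ht := by
    rw [normSq_eq_init_add]
    simp only [Fin.init_snoc, Fin.snoc_last]
    exact (add_le_add_left (hc.bound t ht) _).trans (hbd t ht)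

/-- The straight segment in a cell of dimension one. -/
theorem isJoiningCurve_segment {C : Set (Fin 1 → K)} {x y : Fin 1 → K}
    (hC : ∀ t ∈ Icc (0 : K) 1, x + t • (y - x) ∈ C) {κ : K} (hκ : 1 ≤ κ) :
    IsJoiningCurve κ C x y (fun t => x + t • (y - x)) (fun _ => y - x) where
  source := by simp
  target := by simp
  mapsTo := hC
  hasDeriv t _ := hasDerivUnit_pi.2 fun i => by
    simpa using hasDerivUnit_affine (x i) (y i - x i) t
  continuousOn := continuousOn_const
  bound t _ := by
    rw [normSq_sub_comm]
    exact le_mul_of_one_le_left (normSq_nonneg _) (one_le_pow₀ hκ)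

end Curves

section MFunctions

variable {L : FirstOrder.Language} {K : Type*} [Field K] [LinearOrder K] [IsStrictOrderedRing K]
  [TopologicalSpace K] [OrderTopology K] [L.Structure K]

/-- The derivative of an `M`-function along a curve in its domain. -/
theorem IsMFunction.exists_hasDerivUnit_comp {n m : ℕ} {M κ : K} {X : Set (Fin n → K)}
    {f : (Fin n → K) → (Fin m → K)} {x y : Fin n → K} {c c' : K → Fin n → K}
    (hf : IsMFunction L M X f) (hc : IsJoiningCurve κ X x y c c') {t : K}
    (ht : t ∈ Icc (0 : K) 1) :
    ∃ v, HasDerivUnit (fun s => f (c s)) v t ∧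
      normSq v ≤ (M * κ) ^ 2 * normSq (x - y) := by
  obtain ⟨A, hA, hAb⟩ := hf.2 (c t) (hc.mapsTo ht)
  refine ⟨A.mulVec (c' t), hA.comp_curve (hc.hasDeriv t ht) hc.mapsTo, ?_⟩
  have h1 := hAb _ ((hc.hasDeriv t ht).mem_tangentConeAt ht hc.mapsTo)
  have h2 := mul_le_mul_of_nonneg_left (hc.bound t ht) (sq_nonneg M)
  linarith

/-- A `C¹` scalar `M`-function composed with a curve in its domain is `C¹`. -/
theorem IsMFunction.exists_deriv_comp_of_isC1On {n : ℕ} {M κ : K} {X : Set (Fin n → K)}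
    {f : (Fin n → K) → K} {x y : Fin n → K} {c c' : K → Fin n → K}
    (hf : IsMFunction L M X (fun x (_ : Fin 1) => f x))
    (hf1 : IsC1On (fun x (_ : Fin 1) => f x) X) (hc : IsJoiningCurve κ X x y c c') :
    ∃ b : K → K, ContinuousOn b (Icc 0 1) ∧
      ∀ t ∈ Icc (0 : K) 1, HasDerivUnit (fun s => f (c s)) (b t) t ∧
        b t ^ 2 ≤ (M * κ) ^ 2 * normSq (x - y) := by
  obtain ⟨A, hAc, hA⟩ := hf1
  have hcc : ContinuousOn c (Icc 0 1) := fun t ht => (hc.hasDeriv t ht).continuousWithinAt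
  refine ⟨fun t => (A (c t)).mulVec (c' t) 0, ?_, fun t ht => ?_⟩
  · have h1 := hAc.comp hcc hc.mapsTo
    have h2 := hc.continuousOn
    simp only [Matrix.mulVec, dotProduct]
    refine continuousOn_finsetSum _ fun i _ => ContinuousOn.mul ?_ (continuousOn_pi.1 h2 i)
    exact (continuous_apply_apply (0 : Fin 1) i).comp_continuousOn h1
  · have h := (hA (c t) (hc.mapsTo ht)).comp_curve (hc.hasDeriv t ht) hc.mapsTo
    obtain ⟨v, hv, hvb⟩ := hf.exists_hasDerivUnit_comp hc ht
    rw [hv.unique ht h, normSq_fin_one] at hvb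
    exact ⟨hasDerivUnit_pi.1 h 0, hvb⟩

variable [OMinimalField L K]

/-- An `N`-function on a set whose points are joined by curves with constant `κ` is
`N * κ`-Lipschitz. -/
theorem IsMFunction.isLipschitzOn {n m : ℕ} {N κ : K} {C : Set (Fin n → K)}
    {f : (Fin n → K) → (Fin m → K)} (hf : IsMFunction L N C f) (hC : HasCurves L κ C) :
    IsLipschitzOn (N * κ) C f := by
  intro x hx y hy
  obtain ⟨γ, hγ, hj⟩ := hC
  obtain ⟨γ', hc⟩ := hj (Sum.elim x y) ⟨hx, hy⟩
  have hex : ∀ t : K, ∃ v, t ∈ Icc (0 : K) 1 → HasDerivUnit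
      (fun s => f (γ (Sum.elim x y) s)) v t ∧ normSq v ≤ (N * κ) ^ 2 * normSq (x - y) := by
    intro t
    by_cases ht : t ∈ Icc (0 : K) 1
    · obtain ⟨v, hv⟩ := hf.exists_hasDerivUnit_comp hc ht
      exact ⟨v, fun _ => hv⟩
    · exact ⟨0, fun h => absurd h ht⟩
  choose u' hu' using hex
  -- Extending `f` by zero makes the composite definable without changing it on `[0,1]`.
  have heq : EqOn (fun s j => C.indicator (fun x => f x j) (γ (Sum.elim x y) s))
      (fun s => f (γ (Sum.elim x y) s)) (Icc 0 1) := fun s hs => by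
    ext j
    simp only [indicator_of_mem (hc.mapsTo hs)]
  have h := normSq_sub_le_of_hasDerivUnit (L := L)
    (u := fun s j => C.indicator (fun x => f x j) (γ (Sum.elim x y) s)) (u' := u')
    (fun j => definableFun_family hγ (hf.1.definableFun_indicator j) _)
    (fun t ht => (hu' t ht).1.congr heq ht) (fun t ht => (hu' t ht).2)
    (right_mem_Icc.2 zero_le_one)
  rw [normSq_sub_comm]
  have e0 := heq (left_mem_Icc.2 zero_le_one)
  have e1 := heq (right_mem_Icc.2 zero_le_one)
  simp only [hc.source, hc.target, Sum.elim_comp_inl, Sum.elim_comp_inr] at e0 e1 h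
  rwa [e0, e1] at h

end MFunctions

/-! ### Curves in graphs and bands -/

section Lift

variable {K : Type*} [Field K] [LinearOrder K] [IsStrictOrderedRing K]

theorem sq_convexComb_le {τ a b B : K} (h0 : 0 ≤ τ) (h1 : τ ≤ 1) (ha : a ^ 2 ≤ B)
    (hb : b ^ 2 ≤ B) : ((1 - τ) * a + τ * b) ^ 2 ≤ B := by
  have h2 : 0 ≤ 1 - τ := by linarith
  nlinarith [mul_nonneg (mul_nonneg h0 h2) (sq_nonneg (a - b)), mul_le_mul_of_nonneg_left ha h2,
    mul_le_mul_of_nonneg_left hb h0]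

/-- The estimate for the vertical velocity of a curve at relative height
`τ = lam + t * (μ - lam)` in a band. The endpoints have heights `r` and `s`; `f₀, f₁, fₜ` are the
values of the lower function at the endpoints and at time `t`, `a` is its derivative along the
base curve, similarly `g₀, g₁, gₜ, b` for the upper one, and `D` is the squared distance of the
projections of the endpoints to the base. -/
theorem band_velocity_bound {M κ D f₀ f₁ fₜ g₀ g₁ gₜ a b lam μ τ r s : K} (hM : 0 ≤ M)
    (hκ : 1 ≤ κ) (hD : 0 ≤ D) (hl0 : 0 ≤ lam) (hl1 : lam ≤ 1) (hm0 : 0 ≤ μ) (hm1 : μ ≤ 1)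
    (ht0 : 0 ≤ τ) (ht1 : τ ≤ 1)
    (hr : r = f₀ + lam * (g₀ - f₀)) (hs : s = f₁ + μ * (g₁ - f₁))
    (ha : a ^ 2 ≤ (M * κ) ^ 2 * D) (hb : b ^ 2 ≤ (M * κ) ^ 2 * D)
    (hf : (f₀ - f₁) ^ 2 ≤ M ^ 2 * D) (hg : (g₀ - g₁) ^ 2 ≤ M ^ 2 * D)
    (hft : (fₜ - f₀) ^ 2 ≤ (M * κ) ^ 2 * D) (hgt : (gₜ - g₀) ^ 2 ≤ (M * κ) ^ 2 * D) :
    κ ^ 2 * D + (a + ((μ - lam) * (gₜ - fₜ) + τ * (b - a))) ^ 2 ≤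
      ((3 + 5 * M) * κ) ^ 2 * (D + (r - s) ^ 2) := by
  set p := (1 - τ) * a + τ * b with hp
  set q := (1 - μ) * (f₀ - f₁) + μ * (g₀ - g₁) with hq
  set e := (μ - lam) * ((gₜ - g₀) - (fₜ - f₀)) with he
  have hp2 : p ^ 2 ≤ (M * κ) ^ 2 * D := sq_convexComb_le ht0 ht1 ha hb
  have hq2 : q ^ 2 ≤ M ^ 2 * D := sq_convexComb_le hm0 hm1 hf hg
  have hδ : (μ - lam) ^ 2 ≤ 1 := by
    rw [sq_le_one_iff_abs_le_one, abs_le]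
    constructor <;> linarith
  have he2 : e ^ 2 ≤ 4 * ((M * κ) ^ 2 * D) := by
    rw [he, mul_pow]
    calc _ ≤ 1 * ((gₜ - g₀) - (fₜ - f₀)) ^ 2 := by gcongr
      _ ≤ _ := by nlinarith [sq_nonneg ((gₜ - g₀) + (fₜ - f₀))]
  -- `(μ - lam) * (g₀ - f₀) = (s - r) + q`: the change of relative height is controlled by the
  -- height of the band at the starting point.
  have hsum : a + ((μ - lam) * (gₜ - fₜ) + τ * (b - a)) = p + ((s - r) + q) + e := by
    rw [hp, hq, he, hr, hs]
    ring
  rw [hsum]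
  clear_value p q e
  have hsq : (p + ((s - r) + q) + e) ^ 2 ≤
      3 * p ^ 2 + 6 * (s - r) ^ 2 + 6 * q ^ 2 + 3 * e ^ 2 := by
    linarith [sq_nonneg (p - ((s - r) + q)), sq_nonneg (p - e), sq_nonneg (((s - r) + q) - e),
      sq_nonneg ((s - r) - q)]
  have hκ2 : 1 ≤ κ ^ 2 := one_le_pow₀ hκ
  have hR : 0 ≤ (r - s) ^ 2 := sq_nonneg _
  have h1 : D ≤ κ ^ 2 * D := le_mul_of_one_le_left hD hκ2
  have h2 : M ^ 2 * D ≤ M ^ 2 * (κ ^ 2 * D) := mul_le_mul_of_nonneg_left h1 (sq_nonneg M)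
  have h3 : (r - s) ^ 2 ≤ κ ^ 2 * (r - s) ^ 2 := le_mul_of_one_le_left hR hκ2
  have h4 : 0 ≤ M * (κ ^ 2 * D) := by positivity
  have h5 : 0 ≤ M * (κ ^ 2 * (r - s) ^ 2) := by positivity
  have h6 : 0 ≤ M ^ 2 * (κ ^ 2 * (r - s) ^ 2) := by positivity
  have h7 : 0 ≤ M ^ 2 * (κ ^ 2 * D) := by positivity
  have h8 : (s - r) ^ 2 = (r - s) ^ 2 := by ring
  have h9 : 0 ≤ κ ^ 2 * D := by positivity
  rw [h8] at hsq
  calc _ ≤ κ ^ 2 * D + (3 * ((M * κ) ^ 2 * D) + 6 * (r - s) ^ 2 + 6 * (M ^ 2 * D) +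
        3 * (4 * ((M * κ) ^ 2 * D))) := by linarith
    _ ≤ 9 * (κ ^ 2 * D) + 25 * (M ^ 2 * (κ ^ 2 * D)) + 9 * (κ ^ 2 * (r - s) ^ 2) := by
      have : (M * κ) ^ 2 * D = M ^ 2 * (κ ^ 2 * D) := by ring
      rw [this]
      linarith
    _ ≤ 9 * (κ ^ 2 * D) + 25 * (M ^ 2 * (κ ^ 2 * D)) + 9 * (κ ^ 2 * (r - s) ^ 2) +
        (30 * (M * (κ ^ 2 * D)) + 30 * (M * (κ ^ 2 * (r - s) ^ 2)) +
          25 * (M ^ 2 * (κ ^ 2 * (r - s) ^ 2))) := le_add_of_nonneg_right (by positivity)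
    _ = _ := by ring

/-- The relative height of a point of the band between `f` and `g`. -/
def relHeight {n : ℕ} (f g : (Fin n → K) → K) (z : Fin (n + 1) → K) : K :=
  (z (Fin.last n) - f (Fin.init z)) / (g (Fin.init z) - f (Fin.init z))

theorem relHeight_spec {n : ℕ} {X : Set (Fin n → K)} {f g : (Fin n → K) → K}
    {z : Fin (n + 1) → K} (hz : z ∈ bandOver X f g) :
    0 < relHeight f g z ∧ relHeight f g z < 1 ∧ z (Fin.last n) =
      f (Fin.init z) + relHeight f g z * (g (Fin.init z) - f (Fin.init z)) := by
  obtain ⟨_, h1, h2⟩ := hz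
  have h3 : 0 < g (Fin.init z) - f (Fin.init z) := by linarith
  refine ⟨div_pos (by linarith) h3, (div_lt_one h3).2 (by linarith), ?_⟩
  rw [relHeight, div_mul_cancel₀ _ h3.ne']
  ring

variable [TopologicalSpace K] [OrderTopology K] {L : FirstOrder.Language} [L.Structure K]

theorem IsJoiningCurve.graph {n : ℕ} {M κ : K} {X : Set (Fin n → K)} {f : (Fin n → K) → K}
    (hM : 0 ≤ M) (hf : IsMFunction L M X (fun x (_ : Fin 1) => f x))
    (hf1 : IsC1On (fun x (_ : Fin 1) => f x) X) {x y : Fin (n + 1) → K}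
    (hx : x ∈ graphOver X f) (hy : y ∈ graphOver X f) {c c' : K → Fin n → K}
    (hc : IsJoiningCurve κ X (Fin.init x) (Fin.init y) c c') :
    ∃ d', IsJoiningCurve ((3 + 5 * M) * κ) (graphOver X f) x y
      (fun t => Fin.snoc (c t) (f (c t))) d' := by
  obtain ⟨b', hb'c, hb'⟩ := hf.exists_deriv_comp_of_isC1On hf1 hc
  refine ⟨_, hc.snoc (b := fun t => f (c t)) (b' := b') ?_ ?_ (fun t ht => (hb' t ht).1) hb'c
    (fun t ht => ⟨by simpa using hc.mapsTo ht, by simp⟩) fun t ht => ?_⟩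
  · rw [hc.source, hx.2]
  · rw [hc.target, hy.2]
  · have h1 := (hb' t ht).2
    have h2 : normSq (x - y) = normSq (Fin.init x - Fin.init y) +
      (x (Fin.last n) - y (Fin.last n)) ^ 2 := normSq_eq_init_add _
    have h3 := normSq_nonneg (Fin.init x - Fin.init y)
    rw [h2]
    calc _ ≤ κ ^ 2 * normSq (Fin.init x - Fin.init y) +
          (M * κ) ^ 2 * normSq (Fin.init x - Fin.init y) := by gcongr
      _ = (1 + M ^ 2) * (κ ^ 2 * normSq (Fin.init x - Fin.init y)) := by ring
      _ ≤ (3 + 5 * M) ^ 2 * (κ ^ 2 * normSq (Fin.init x - Fin.init y)) := by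
        gcongr
        nlinarith
      _ = ((3 + 5 * M) * κ) ^ 2 * normSq (Fin.init x - Fin.init y) := by ring
      _ ≤ _ := by gcongr; exact le_add_of_nonneg_right (sq_nonneg _)

theorem IsJoiningCurve.band [OMinimalField L K] {n : ℕ} {M κ : K} {X : Set (Fin n → K)}
    {f g : (Fin n → K) → K} (hM : 0 ≤ M) (hκ : 1 ≤ κ)
    (hf : IsMFunction L M X (fun x (_ : Fin 1) => f x))
    (hf1 : IsC1On (fun x (_ : Fin 1) => f x) X)
    (hfL : IsLipschitzOn M X (fun x (_ : Fin 1) => f x))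
    (hg : IsMFunction L M X (fun x (_ : Fin 1) => g x))
    (hg1 : IsC1On (fun x (_ : Fin 1) => g x) X)
    (hgL : IsLipschitzOn M X (fun x (_ : Fin 1) => g x)) (hfg : ∀ x ∈ X, f x < g x)
    {x y : Fin (n + 1) → K} (hx : x ∈ bandOver X f g) (hy : y ∈ bandOver X f g)
    {c c' : K → Fin n → K} (hc : IsJoiningCurve κ X (Fin.init x) (Fin.init y) c c')
    (hcd : ∀ i, (univ : Set K).DefinableFun L (fun v : Fin 1 → K => c (v 0) i)) :
    ∃ d', IsJoiningCurve ((3 + 5 * M) * κ) (bandOver X f g) x y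
      (fun t => Fin.snoc (c t) (f (c t) + (relHeight f g x +
        t * (relHeight f g y - relHeight f g x)) * (g (c t) - f (c t)))) d' := by
  obtain ⟨a, hac, ha⟩ := hf.exists_deriv_comp_of_isC1On hf1 hc
  obtain ⟨b, hbc, hb⟩ := hg.exists_deriv_comp_of_isC1On hg1 hc
  obtain ⟨hl0, hl1, hxr⟩ := relHeight_spec hx
  obtain ⟨hm0, hm1, hys⟩ := relHeight_spec hy
  set lam := relHeight f g x
  set μ := relHeight f g y
  clear_value lam μ
  have hτ : ∀ t ∈ Icc (0 : K) 1, 0 < lam + t * (μ - lam) ∧ lam + t * (μ - lam) < 1 := by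
    rintro t ⟨h0, h1⟩
    have e : lam + t * (μ - lam) = (1 - t) * lam + t * μ := by ring
    rw [e]
    constructor
    · nlinarith [mul_nonneg h0 hm0.le, mul_nonneg (sub_nonneg.2 h1) hl0.le]
    · nlinarith [mul_nonneg h0 (sub_pos.2 hm1).le, mul_nonneg (sub_nonneg.2 h1) (sub_pos.2 hl1).le]
  have hfc : ContinuousOn (fun t => f (c t)) (Icc 0 1) :=
    fun t ht => (ha t ht).1.continuousWithinAt
  have hgc : ContinuousOn (fun t => g (c t)) (Icc 0 1) :=
    fun t ht => (hb t ht).1.continuousWithinAt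
  have hbase : ∀ t ∈ Icc (0 : K) 1, normSq (c t - Fin.init x) ≤
      κ ^ 2 * normSq (Fin.init x - Fin.init y) := fun t ht => by
    have := normSq_sub_le_of_hasDerivUnit (L := L) hcd hc.hasDeriv hc.bound ht
    rwa [hc.source] at this
  have hlip : ∀ φ : (Fin n → K) → K, IsLipschitzOn M X (fun x (_ : Fin 1) => φ x) →
      ∀ t ∈ Icc (0 : K) 1, (φ (c t) - φ (Fin.init x)) ^ 2 ≤
        (M * κ) ^ 2 * normSq (Fin.init x - Fin.init y) := fun φ hφ t ht => by
    have h1 := hφ _ (hc.mapsTo ht) _ hx.1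
    rw [normSq_fin_one] at h1
    refine h1.trans ?_
    have := mul_le_mul_of_nonneg_left (hbase t ht) (sq_nonneg M)
    linarith
  have hlip' : ∀ φ : (Fin n → K) → K, IsLipschitzOn M X (fun x (_ : Fin 1) => φ x) →
      (φ (Fin.init x) - φ (Fin.init y)) ^ 2 ≤
        M ^ 2 * normSq (Fin.init x - Fin.init y) := fun φ hφ => by
    have h1 := hφ _ hx.1 _ hy.1
    rwa [normSq_fin_one] at h1
  refine ⟨_, hc.snoc
    (b := fun t => f (c t) + (lam + t * (μ - lam)) * (g (c t) - f (c t)))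
    (b' := fun t => a t + ((μ - lam) * (g (c t) - f (c t)) +
      (lam + t * (μ - lam)) * (b t - a t))) ?_ ?_ ?_ ?_ ?_ ?_⟩
  · simp only [hc.source, zero_mul, add_zero]
    exact hxr.symm
  · simp only [hc.target, one_mul, add_sub_cancel]
    exact hys.symm
  · intro t ht
    have h1 := (ha t ht).1
    exact h1.add ((hasDerivUnit_affine lam (μ - lam) t).mul ((hb t ht).1.sub h1))
  · have hτc : ContinuousOn (fun t : K => lam + t * (μ - lam)) (Icc 0 1) :=
      (continuous_const.add (continuous_id.mul continuous_const)).continuousOn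
    exact hac.add ((continuousOn_const.mul (hgc.sub hfc)).add (hτc.mul (hbc.sub hac)))
  · intro t ht
    have h1 := hfg _ (hc.mapsTo ht)
    obtain ⟨h2, h3⟩ := hτ t ht
    refine ⟨by simpa using hc.mapsTo ht, ?_, ?_⟩
    · simp only [Fin.init_snoc, Fin.snoc_last]
      exact lt_add_of_pos_right _ (mul_pos h2 (sub_pos.2 h1))
    · simp only [Fin.init_snoc, Fin.snoc_last]
      nlinarith [mul_pos (sub_pos.2 h3) (sub_pos.2 h1)]
  · intro t ht
    have h2 : normSq (x - y) = normSq (Fin.init x - Fin.init y) +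
      (x (Fin.last n) - y (Fin.last n)) ^ 2 := normSq_eq_init_add _
    rw [h2]
    exact band_velocity_bound hM hκ (normSq_nonneg _) hl0.le hl1.le hm0.le hm1.le
      (hτ t ht).1.le (hτ t ht).2.le hxr hys (ha t ht).2 (hb t ht).2 (hlip' f hfL) (hlip' g hgL)
      (hlip f hfL t ht) (hlip g hgL t ht)

end Lift

/-! ### Definable families of curves in Lipschitz cells -/

section Families

variable {L : FirstOrder.Language} {K : Type*} [L.Structure K]

/-- A definable family of curves in the base, reindexed by pairs of points of `K^(n+1)`. -/
theorem definableMap_family_init {n : ℕ} {γ : (Fin n ⊕ Fin n → K) → K → (Fin n → K)}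
    (hγ : (univ : Set K).DefinableMap L
      (fun w : (Fin n ⊕ Fin n) ⊕ Unit → K => γ (w ∘ Sum.inl) (w (Sum.inr ())))) :
    (univ : Set K).DefinableMap L
      (fun w : (Fin (n + 1) ⊕ Fin (n + 1)) ⊕ Unit → K =>
        γ (Sum.elim (Fin.init (w ∘ Sum.inl ∘ Sum.inl)) (Fin.init (w ∘ Sum.inl ∘ Sum.inr)))
          (w (Sum.inr ()))) := by
  intro i
  refine (hγ i).comp (g := fun w : (Fin (n + 1) ⊕ Fin (n + 1)) ⊕ Unit → K =>
    Sum.elim (Sum.elim (Fin.init (w ∘ Sum.inl ∘ Sum.inl)) (Fin.init (w ∘ Sum.inl ∘ Sum.inr)))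
      (fun _ => w (Sum.inr ()))) ?_
  rintro ((i | i) | i) <;> exact .proj L

theorem definableMap_snoc {α : Type*} {n : ℕ} {F : (α → K) → (Fin n → K)} {G : (α → K) → K}
    (hF : (univ : Set K).DefinableMap L F) (hG : (univ : Set K).DefinableFun L G) :
    (univ : Set K).DefinableMap L (fun v => (Fin.snoc (F v) (G v) : Fin (n + 1) → K)) := by
  intro i
  refine Fin.lastCases ?_ (fun i => ?_) i
  · simpa using hG
  · simpa using hF i

variable [Field K] [LinearOrder K] [IsStrictOrderedRing K] [OMinimalField L K]

theorem definableFun_relHeight {α : Type*} {n : ℕ} {f g : (Fin n → K) → K}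
    (hf : (univ : Set K).DefinableFun L f) (hg : (univ : Set K).DefinableFun L g)
    {z : (α → K) → (Fin (n + 1) → K)} (hz : (univ : Set K).DefinableMap L z) :
    (univ : Set K).DefinableFun L (fun v => relHeight f g (z v)) := by
  have hf' := hf.comp (g := fun v => Fin.init (z v)) fun i => hz i.castSucc
  have hg' := hg.comp (g := fun v => Fin.init (z v)) fun i => hz i.castSucc
  exact definableFun_div (definableFun_sub (hz _) hf') (definableFun_sub hg' hf')

variable [TopologicalSpace K]

theorem hasCurves_of_segment_mem {C : Set (Fin 1 → K)}
    (hC : ∀ x ∈ C, ∀ y ∈ C, ∀ t ∈ Icc (0 : K) 1, x + t • (y - x) ∈ C) {κ : K} (hκ : 1 ≤ κ) :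
    HasCurves L κ C :=
  ⟨fun w t => w ∘ Sum.inl + t • (w ∘ Sum.inr - w ∘ Sum.inl),
    fun _ => definableFun_add (.proj L) (definableFun_mul (.proj L)
      (definableFun_sub (.proj L) (.proj L))),
    fun _ hw => ⟨_, isJoiningCurve_segment (hC _ hw.1 _ hw.2) hκ⟩⟩

theorem IsLipschitzCell.definable {n : ℕ} {M : K} {C : Set (Fin n → K)}
    (hC : IsLipschitzCell L M C) : (univ : Set K).Definable L C := by
  unfold IsLipschitzCell at hC
  induction hC with
  | point r => exact (DefinableFun.proj L).ofPred_eq (definableFun_const r)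
  | interval a b hab =>
    exact (definable_lt (definableFun_const a) (.proj L)).inter
      (definable_lt (.proj L) (definableFun_const b))
  | @graph n X f hX hf ih =>
    have hX' := ih.preimage_comp (Fin.castSucc : Fin n → Fin (n + 1))
    have hF := (hf.1.1.1.definableFun_indicator 0).comp (g := fun z : Fin (n + 1) → K => Fin.init z)
      fun i => .proj L
    convert! hX'.inter ((DefinableFun.proj L (i := Fin.last n)).ofPred_eq hF) using 1
    ext z
    refine and_congr_right fun hz => ?_
    rw [mem_ofPred_eq, indicator_of_mem hz]
  | @band n X f g hX hf hg hfg ih =>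
    have hX' := ih.preimage_comp (Fin.castSucc : Fin n → Fin (n + 1))
    have hF := (hf.1.1.1.definableFun_indicator 0).comp (g := fun z : Fin (n + 1) → K => Fin.init z)
      fun i => .proj L
    have hG := (hg.1.1.1.definableFun_indicator 0).comp (g := fun z : Fin (n + 1) → K => Fin.init z)
      fun i => .proj L
    convert! hX'.inter ((definable_lt hF (DefinableFun.proj L (i := Fin.last n))).inter
      (definable_lt (DefinableFun.proj L (i := Fin.last n)) hG)) using 1
    ext z
    refine and_congr_right fun hz => ?_
    rw [mem_inter_iff, mem_ofPred_eq, mem_ofPred_eq, indicator_of_mem hz, indicator_of_mem hz]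

variable [OrderTopology K]

omit [OMinimalField L K] in
theorem HasCurves.graph {n : ℕ} {M κ : K} {X : Set (Fin n → K)} {f : (Fin n → K) → K}
    (hX : HasCurves L κ X) (hM : 0 ≤ M) (hf : IsMFunction L M X (fun x (_ : Fin 1) => f x))
    (hf1 : IsC1On (fun x (_ : Fin 1) => f x) X) :
    HasCurves L ((3 + 5 * M) * κ) (graphOver X f) := by
  obtain ⟨γ, hγ, hj⟩ := hX
  have hγ' := definableMap_family_init hγ
  have hF := hf.1.definableFun_indicator 0
  refine ⟨fun w t => Fin.snoc (γ (Sum.elim (Fin.init (w ∘ Sum.inl)) (Fin.init (w ∘ Sum.inr))) t)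
    (X.indicator f (γ (Sum.elim (Fin.init (w ∘ Sum.inl)) (Fin.init (w ∘ Sum.inr))) t)),
    definableMap_snoc hγ' (hF.comp hγ'), fun w hw => ?_⟩
  obtain ⟨c', hc⟩ := hj (Sum.elim (Fin.init (w ∘ Sum.inl)) (Fin.init (w ∘ Sum.inr)))
    ⟨hw.1.1, hw.2.1⟩
  obtain ⟨d', hd⟩ := hc.graph hM hf hf1 hw.1 hw.2
  exact ⟨d', hd.congr fun t ht => by simp only [indicator_of_mem (hc.mapsTo ht)]⟩

theorem HasCurves.band {n : ℕ} {M κ : K} {X : Set (Fin n → K)} {f g : (Fin n → K) → K}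
    (hX : HasCurves L κ X) (hM : 0 ≤ M) (hκ : 1 ≤ κ)
    (hf : IsMFunction L M X (fun x (_ : Fin 1) => f x))
    (hf1 : IsC1On (fun x (_ : Fin 1) => f x) X)
    (hfL : IsLipschitzOn M X (fun x (_ : Fin 1) => f x))
    (hg : IsMFunction L M X (fun x (_ : Fin 1) => g x))
    (hg1 : IsC1On (fun x (_ : Fin 1) => g x) X)
    (hgL : IsLipschitzOn M X (fun x (_ : Fin 1) => g x)) (hfg : ∀ x ∈ X, f x < g x) :
    HasCurves L ((3 + 5 * M) * κ) (bandOver X f g) := by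
  obtain ⟨γ, hγ, hj⟩ := hX
  have hγ' := definableMap_family_init hγ
  have hF : (univ : Set K).DefinableFun L (X.indicator f) := hf.1.definableFun_indicator 0
  have hG : (univ : Set K).DefinableFun L (X.indicator g) := hg.1.definableFun_indicator 0
  have hF' := hF.comp hγ'
  have hG' := hG.comp hγ'
  have hx := definableFun_relHeight hF hG
    (z := fun w : (Fin (n + 1) ⊕ Fin (n + 1)) ⊕ Unit → K => w ∘ Sum.inl ∘ Sum.inl)
    fun i => .proj L
  have hy := definableFun_relHeight hF hG
    (z := fun w : (Fin (n + 1) ⊕ Fin (n + 1)) ⊕ Unit → K => w ∘ Sum.inl ∘ Sum.inr)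
    fun i => .proj L
  refine ⟨fun w t => Fin.snoc (γ (Sum.elim (Fin.init (w ∘ Sum.inl)) (Fin.init (w ∘ Sum.inr))) t)
    (X.indicator f (γ (Sum.elim (Fin.init (w ∘ Sum.inl)) (Fin.init (w ∘ Sum.inr))) t) +
      (relHeight (X.indicator f) (X.indicator g) (w ∘ Sum.inl) +
        t * (relHeight (X.indicator f) (X.indicator g) (w ∘ Sum.inr) -
          relHeight (X.indicator f) (X.indicator g) (w ∘ Sum.inl))) *
      (X.indicator g (γ (Sum.elim (Fin.init (w ∘ Sum.inl)) (Fin.init (w ∘ Sum.inr))) t) -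
        X.indicator f (γ (Sum.elim (Fin.init (w ∘ Sum.inl)) (Fin.init (w ∘ Sum.inr))) t))),
    definableMap_snoc hγ' (definableFun_add hF' (definableFun_mul (definableFun_add hx
      (definableFun_mul (.proj L) (definableFun_sub hy hx))) (definableFun_sub hG' hF'))),
    fun w hw => ?_⟩
  obtain ⟨c', hc⟩ := hj (Sum.elim (Fin.init (w ∘ Sum.inl)) (Fin.init (w ∘ Sum.inr)))
    ⟨hw.1.1, hw.2.1⟩
  obtain ⟨d', hd⟩ := hc.band hM hκ hf hf1 hfL hg hg1 hgL hfg hw.1 hw.2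
    fun i => definableFun_family hγ (F := fun u => u i) (.proj L) _
  refine ⟨d', hd.congr fun t ht => ?_⟩
  simp only [relHeight, indicator_of_mem (hc.mapsTo ht), indicator_of_mem hw.1.1,
    indicator_of_mem hw.2.1]

/-- Points of an `M`-Lipschitz cell are joined by curves, with the constant growing by the factor
`3 + 5 * M` in each dimension. -/
theorem IsLipschitzCell.hasCurves {n : ℕ} {M : K} (hM : 0 < M) {C : Set (Fin n → K)}
    (hC : IsLipschitzCell L M C) : HasCurves L ((3 + 5 * M) ^ n) C := by
  have h1 : ∀ n : ℕ, 1 ≤ (3 + 5 * M) ^ n := fun n => one_le_pow₀ (by linarith)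
  unfold IsLipschitzCell at hC
  induction hC with
  | point r =>
    refine hasCurves_of_segment_mem (fun x hx y hy t ht => ?_) (h1 1)
    simp only [mem_ofPred_eq, Pi.add_apply, Pi.smul_apply, Pi.sub_apply, smul_eq_mul] at *
    rw [hx, hy]
    ring
  | interval a b hab =>
    refine hasCurves_of_segment_mem (fun x hx y hy t ht => ?_) (h1 1)
    have := (convex_Ioo a b).add_smul_sub_mem (𝕜 := K) hx hy ht
    simpa using this
  | graph hX hf ih =>
    rw [pow_succ']
    exact ih.graph hM.le hf.1.1 hf.1.2
  | band hX hf hg hfg ih =>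
    rw [pow_succ']
    exact ih.band hM.le (h1 _) hf.1.1 hf.1.2 hf.2 hg.1.1 hg.1.2 hg.2 hfg

theorem HasCurves.exists_isDefinableFamilyOfCurves {n : ℕ} {κ : K} {C : Set (Fin n → K)}
    (h : HasCurves L κ C) (hC : (univ : Set K).Definable L C) :
    ∃ γ : (Fin n ⊕ Fin n → K) → K → (Fin n → K),
      IsDefinableFamilyOfCurves L (square C) C γ ∧
      ∀ x ∈ C, ∀ y ∈ C, γ (Sum.elim x y) 0 = x ∧ γ (Sum.elim x y) 1 = y ∧
        ∃ γ' : K → (Fin n → K), IsC1Curve (γ (Sum.elim x y)) γ' ∧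
          ∀ t ∈ Icc (0 : K) 1, normSq (γ' t) ≤ κ ^ 2 * normSq (x - y) := by
  obtain ⟨γ, hγ, hj⟩ := h
  refine ⟨γ, ⟨?_, fun w hw t ht => ?_⟩, fun x hx y hy => ?_⟩
  · have h1 := hC.preimage_comp (fun i => (Sum.inl (Sum.inl i) :
      (Fin n ⊕ Fin n) ⊕ (Unit ⊕ Fin n)))
    have h2 := hC.preimage_comp (fun i => (Sum.inl (Sum.inr i) :
      (Fin n ⊕ Fin n) ⊕ (Unit ⊕ Fin n)))
    have h3 : (univ : Set K).Definable L
        {w : (Fin n ⊕ Fin n) ⊕ (Unit ⊕ Fin n) → K | 0 ≤ w (Sum.inr (Sum.inl ()))} :=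
      definable_le (definableFun_const 0) (.proj L)
    have h4 : (univ : Set K).Definable L
        {w : (Fin n ⊕ Fin n) ⊕ (Unit ⊕ Fin n) → K | w (Sum.inr (Sum.inl ())) ≤ 1} :=
      definable_le (.proj L) (definableFun_const 1)
    have h5 : ∀ i : Fin n, (univ : Set K).Definable L
        {w : (Fin n ⊕ Fin n) ⊕ (Unit ⊕ Fin n) → K |
          w (Sum.inr (Sum.inr i)) = γ (w ∘ Sum.inl) (w (Sum.inr (Sum.inl ()))) i} := fun i =>
      (DefinableFun.proj L).ofPred_eq ((hγ i).comp
        (g := fun w : (Fin n ⊕ Fin n) ⊕ (Unit ⊕ Fin n) → K =>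
          w ∘ Sum.map id (fun _ => Sum.inl ())) fun _ => .proj L)
    convert! (h1.inter h2).inter ((h3.inter h4).inter (definable_iInter_of_finite h5)) using 1
    ext w
    simp only [mem_inter_iff, mem_iInter]
    exact and_congr_right fun _ => and_congr_right fun _ => funext_iff
  · obtain ⟨γ', hc⟩ := hj w hw
    exact hc.mapsTo ht
  · obtain ⟨γ', hc⟩ := hj (Sum.elim x y) ⟨hx, hy⟩
    exact ⟨hc.source, hc.target, γ', isC1Curve_of_hasDerivUnit hc.continuousOn hc.hasDeriv,
      hc.bound⟩

end Families

/-! ### Lipschitz constants -/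

theorem IsCellWith.mono {K : Type*} [LinearOrder K]
    {P Q : ∀ n : ℕ, Set (Fin n → K) → ((Fin n → K) → K) → Prop}
    (h : ∀ n X f, P n X f → Q n X f) {n : ℕ} {C : Set (Fin n → K)} (hC : IsCellWith P n C) :
    IsCellWith Q n C := by
  induction hC with
  | point r => exact .point r
  | interval a b hab => exact .interval a b hab
  | graph _ hf ih => exact .graph ih (h _ _ _ hf)
  | band _ hf hg hfg ih => exact .band ih (h _ _ _ hf) (h _ _ _ hg) hfg

section Constants

variable {K : Type*} [Field K] [LinearOrder K] [IsStrictOrderedRing K]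

theorem IsFiniteElt.add {x y : K} (hx : IsFiniteElt x) (hy : IsFiniteElt y) :
    IsFiniteElt (x + y) := by
  obtain ⟨a, ha⟩ := hx
  obtain ⟨b, hb⟩ := hy
  refine ⟨a + b, (abs_add_le x y).trans ?_⟩
  push_cast
  exact add_le_add ha hb

theorem IsFiniteElt.mul {x y : K} (hx : IsFiniteElt x) (hy : IsFiniteElt y) :
    IsFiniteElt (x * y) := by
  obtain ⟨a, ha⟩ := hx
  obtain ⟨b, hb⟩ := hy
  refine ⟨a * b, ?_⟩
  rw [abs_mul]
  push_cast
  gcongr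

theorem isFiniteElt_natCast (n : ℕ) : IsFiniteElt (n : K) :=
  ⟨n, by simp⟩

theorem IsFiniteElt.pow {x : K} (hx : IsFiniteElt x) (n : ℕ) : IsFiniteElt (x ^ n) := by
  induction n with
  | zero => simpa using isFiniteElt_natCast (K := K) 1
  | succ n ih => rw [pow_succ]; exact ih.mul hx

theorem IsFiniteElt.curveConst {x : K} (hx : IsFiniteElt x) (n : ℕ) :
    IsFiniteElt ((3 + 5 * x) ^ n) := by
  refine IsFiniteElt.pow (IsFiniteElt.add ?_ (IsFiniteElt.mul ?_ hx)) n
  · exact_mod_cast isFiniteElt_natCast (K := K) 3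
  · exact_mod_cast isFiniteElt_natCast (K := K) 5

/-- The Lipschitz constant of the defining functions of an `M`-cell in `K^n`: an `M`-function on
an `M`-cell `X` in `K^n` has Lipschitz constant `M` times that of the curves in `X`. -/
def lipConst (M : K) : ℕ → K
  | 0 => M
  | n + 1 => lipConst M n + M * (3 + 5 * lipConst M n) ^ n

theorem lipConst_pos {M : K} (hM : 0 < M) (n : ℕ) : 0 < lipConst M n := by
  induction n with
  | zero => exact hM
  | succ n ih => rw [lipConst]; positivity

theorem lipConst_le_succ {M : K} (hM : 0 < M) (n : ℕ) : lipConst M n ≤ lipConst M (n + 1) := by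
  have := lipConst_pos hM n
  rw [lipConst]
  exact le_add_of_nonneg_right (by positivity)

theorem le_lipConst {M : K} (hM : 0 < M) (n : ℕ) : M ≤ lipConst M n := by
  induction n with
  | zero => exact le_rfl
  | succ n ih => exact ih.trans (lipConst_le_succ hM n)

theorem IsFiniteElt.lipConst {M : K} (hM : IsFiniteElt M) (n : ℕ) : IsFiniteElt (lipConst M n) := by
  induction n with
  | zero => exact hM
  | succ n ih => exact ih.add (hM.mul (ih.curveConst n))

theorem IsLipschitzOn.mono {n m : ℕ} {c d : K} (hc : 0 ≤ c) (hcd : c ≤ d) {X : Set (Fin n → K)}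
    {f : (Fin n → K) → (Fin m → K)} (hf : IsLipschitzOn c X f) : IsLipschitzOn d X f :=
  fun x hx y hy => (hf x hx y hy).trans
    (mul_le_mul_of_nonneg_right (pow_le_pow_left₀ hc hcd 2) (normSq_nonneg _))

variable {L : FirstOrder.Language} [L.Structure K] [TopologicalSpace K]

theorem IsMFunction.mono {n m : ℕ} {M N : K} (hM : 0 ≤ M) (hMN : M ≤ N) {X : Set (Fin n → K)}
    {f : (Fin n → K) → (Fin m → K)} (hf : IsMFunction L M X f) : IsMFunction L N X f :=
  ⟨hf.1, fun x hx => let ⟨A, hA, hb⟩ := hf.2 x hx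
    ⟨A, hA, fun v hv => (hb v hv).trans
      (mul_le_mul_of_nonneg_right (pow_le_pow_left₀ hM hMN 2) (normSq_nonneg _))⟩⟩

theorem IsLipschitzCell.mono {n : ℕ} {M N : K} (hM : 0 ≤ M) (hMN : M ≤ N) {C : Set (Fin n → K)}
    (hC : IsLipschitzCell L M C) : IsLipschitzCell L N C :=
  IsCellWith.mono (fun _ _ _ h => ⟨⟨h.1.1.mono hM hMN, h.1.2⟩, h.2.mono hM hMN⟩) hC

variable [OrderTopology K] [OMinimalField L K]

/-- Every function that defines an `M`-cell is Lipschitz, since its domain is, by induction, a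
Lipschitz cell, hence joined by curves. -/
theorem IsMCell.isLipschitzCell {n : ℕ} {M : K} (hM : 0 < M) {C : Set (Fin n → K)}
    (hC : IsMCell L M C) : IsLipschitzCell L (lipConst M n) C := by
  have key : ∀ {n : ℕ} {X : Set (Fin n → K)} {f : (Fin n → K) → K},
      IsLipschitzCell L (lipConst M n) X → IsMFunction L M X (fun x (_ : Fin 1) => f x) ∧
        IsC1On (fun x (_ : Fin 1) => f x) X →
      (IsMFunction L (lipConst M (n + 1)) X (fun x (_ : Fin 1) => f x) ∧
        IsC1On (fun x (_ : Fin 1) => f x) X) ∧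
        IsLipschitzOn (lipConst M (n + 1)) X (fun x (_ : Fin 1) => f x) := by
    intro n X f hX hf
    have hpos := lipConst_pos hM n
    refine ⟨⟨hf.1.mono hM.le (le_lipConst hM _), hf.2⟩,
      (hf.1.isLipschitzOn (hX.hasCurves hpos)).mono (by positivity) ?_⟩
    exact le_add_of_nonneg_left hpos.le
  unfold IsMCell at hC
  induction hC with
  | point r => exact .point r
  | interval a b hab => exact .interval a b hab
  | @graph n X f hX hf ih =>
    exact .graph (IsLipschitzCell.mono (lipConst_pos hM n).le (lipConst_le_succ hM n) ih)
      (key ih hf)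
  | @band n X f g hX hf hg hfg ih =>
    exact .band (IsLipschitzCell.mono (lipConst_pos hM n).le (lipConst_le_succ hM n) ih)
      (key ih hf) (key ih hg) hfg

end Constants

end OMin

theorem theoremK (L : FirstOrder.Language) (K : Type*) [Field K] [LinearOrder K]
    [IsStrictOrderedRing K] [TopologicalSpace K] [OrderTopology K] [L.Structure K]
    [OMin.OMinimalField L K] :
    -- every `M`-cell in `K^n` is a `k(n, M)`-Lipschitz cell
    (∃ k : ℕ → K → K, ∀ (n : ℕ) (M : K), 0 < n → 0 < M →
      0 < k n M ∧ (OMin.IsFiniteElt M → OMin.IsFiniteElt (k n M)) ∧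
      ∀ C : Set (Fin n → K), OMin.IsMCell L M C → OMin.IsLipschitzCell L (k n M) C) ∧
    -- points of an `M`-Lipschitz cell are joined by a definable family of `C¹`-curves
    (∃ κ : ℕ → K → K, ∀ (n : ℕ) (M : K), 0 < n → 0 < M →
      0 < κ n M ∧ (OMin.IsFiniteElt M → OMin.IsFiniteElt (κ n M)) ∧
      ∀ C : Set (Fin n → K), OMin.IsLipschitzCell L M C →
        ∃ γ : (Fin n ⊕ Fin n → K) → K → (Fin n → K),
          OMin.IsDefinableFamilyOfCurves L (OMin.square C) C γ ∧
          ∀ x ∈ C, ∀ y ∈ C,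
            γ (Sum.elim x y) 0 = x ∧ γ (Sum.elim x y) 1 = y ∧
            ∃ γ' : K → (Fin n → K), OMin.IsC1Curve (γ (Sum.elim x y)) γ' ∧
              ∀ t ∈ Set.Icc (0 : K) 1,
                OMin.normSq (γ' t) ≤ κ n M ^ 2 * OMin.normSq (x - y)) ∧
    -- a definable `N`-function on an `M`-cell is Lipschitz
    (∀ (n m : ℕ) (M N : K), 0 < M → 0 < N →
      ∀ (C : Set (Fin n → K)) (f : (Fin n → K) → (Fin m → K)),
        OMin.IsMCell L M C → OMin.IsMFunction L N C f →
        ∃ c : K, 0 < c ∧ OMin.IsLipschitzOn c C f ∧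
          (OMin.IsFiniteElt M → OMin.IsFiniteElt N → OMin.IsFiniteElt c)) := by
  refine ⟨⟨fun n M => OMin.lipConst M n, fun n M _ hM =>
      ⟨OMin.lipConst_pos hM n, fun h => h.lipConst n, fun C hC => hC.isLipschitzCell hM⟩⟩,
    ⟨fun n M => (3 + 5 * M) ^ n, fun n M _ hM =>
      ⟨by positivity, fun h => h.curveConst n, fun C hC =>
        (hC.hasCurves hM).exists_isDefinableFamilyOfCurves hC.definable⟩⟩,
    fun n m M N hM hN C f hC hf => ?_⟩
  have hpos := OMin.lipConst_pos hM n
  exact ⟨N * (3 + 5 * OMin.lipConst M n) ^ n, by positivity,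
    hf.isLipschitzOn ((hC.isLipschitzCell hM).hasCurves hpos),
    fun h1 h2 => h2.mul ((h1.lipConst n).curveConst n)⟩
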